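/- Let $K$ be a quadratic number field in which $3$ ramifies, and let $L/K$ be a finite Galois extension of degree $n$ that is unramified at every finite prime not above $3$ (no condition is imposed at the infinite places). Let the ramification index in $L/K$ of the primes of $L$ above $3$ (it is the same for all of them) be $e\cdot 3^m$ with $m \ge 1$ and $3 \nmid e$. Assume that $\mathrm{Gal}(L/K)$ embeds into $\mathrm{GL}_2(\mathbb{F}_{3^a})$ for some $a \ge 1$. Then the absolute discriminants $d_K$, $d_L$ of $K$ and $L$ over $\mathbb{Q}$ satisfy $$|d_L| \le |d_K|^n \cdot 3^{2cn}$$ for some real number $$c \le 2 - \frac{1}{2\cdot 3^{m-1}} - \frac{1}{2e\cdot 3^m}.$$ -/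

import Mathlib

open scoped NumberField MatrixGroups

/-! ### Expansions in a uniformizer for totally ramified groups. -/

section ValuationExpansion

open WithZero Polynomial

/-! Since `d_L` is, up to sign, `d_K ^ n` times the norm of the different of `L/K`, and the
different lives above the unique prime `p ∣ 3` of `K` (of norm `3`), it suffices to bound its
exponent at each `Q ∣ p` by `B = (3 ^ m - 1) * (3 * e + 1) + 3 ^ m * (e - 1)`; then `B / (e * 3 ^ m)
= 2 * c`.

Let `I` be the inertia group at `Q`, `W` its Sylow `3`-subgroup, and `T ⊆ M` their fixed fields.
`T/K` is unramified below `Q`, and `M/T` is totally and tamely ramified of degree `e`, contributing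
`3 ^ m * (e - 1)`. The wild step `L/M` is `differentIdeal_exponent_le`.

A `3`-subgroup of `GL₂` in characteristic `3` is elementary abelian
(`IsPGroup.commute_and_pow_eq_one_of_injective`). In each cubic layer over `M` the different
exponent is at most that of `3 * y ^ 2`, for `y` a uniformizer, namely `3 * k + 2` with `k = 2 * e`
the valuation of `3` in `M`. Averaging over the characters of `W` turns this into the bound for
`L/M`. Everything uses the `Q`-adic valuation on `L` itself, without completing. -/

theorem Valuation.map_le_map_sum_of_pairwise_ne {L Γ ι : Type*} [Field L]
    [LinearOrderedCommGroupWithZero Γ] (v : Valuation L Γ) (s : Finset ι) (t : ι → L)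
    (h : ∀ i ∈ s, ∀ j ∈ s, i ≠ j → t i ≠ 0 → v (t i) ≠ v (t j)) {j : ι} (hj : j ∈ s) :
    v (t j) ≤ v (∑ i ∈ s, t i) := by
  classical
  obtain ⟨k, hk, hmax⟩ := s.exists_max_image (fun i => v (t i)) ⟨j, hj⟩
  refine (hmax j hj).trans ?_
  rcases eq_or_ne (t k) 0 with h0 | h0
  · simp [h0]
  rw [← Finset.add_sum_erase s t hk, v.map_add_eq_of_lt_left]
  refine v.map_sum_lt ((v.ne_zero_iff).2 h0) fun i hi => ?_
  rw [Finset.mem_erase] at hi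
  exact lt_of_le_of_ne (hmax i hi.2) (h k hk i hi.2 hi.1.symm h0).symm

variable {L W : Type*} [Field L] [Group W] [Finite W] [MulSemiringAction W L]

theorem exp_mul_sub_ne {N : ℕ} {i j : ℕ} (hi : i < N) (hj : j < N) (hij : i ≠ j) (k l : ℤ) :
    (exp ((N : ℤ) * k) * exp (-(1 : ℤ)) ^ i : ℤᵐ⁰) ≠ exp ((N : ℤ) * l) * exp (-(1 : ℤ)) ^ j := by
  rw [← exp_nsmul, ← exp_nsmul, ← exp_add, ← exp_add, Ne, exp_inj]
  intro h
  simp only [nsmul_eq_mul] at h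
  have h1 : (N : ℤ) ∣ (i : ℤ) - j := ⟨k - l, by linarith⟩
  have := Int.eq_zero_of_abs_lt_dvd h1 (by rw [abs_lt]; constructor <;> omega)
  omega

/-- `hF` encodes total ramification. The terms `a i * x ^ i` then have valuations distinct modulo
`|W|`, so nothing cancels: the powers of `x` are independent over the fixed field, hence a basis by
counting, and integrality can be read off termwise. -/
theorem exists_fixed_expansion [FaithfulSMul W L] (v : Valuation L ℤᵐ⁰)
    (hF : ∀ z : L, z ≠ 0 → (∀ σ : W, σ • z = z) → ∃ k : ℤ, v z = exp ((Nat.card W : ℤ) * k))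
    {x : L} (hx : v x = exp (-1 : ℤ)) (z : L) :
    ∃ a : Fin (Nat.card W) → L, (∀ i (σ : W), σ • a i = a i) ∧
      (v z ≤ 1 → ∀ i, v (a i) ≤ 1) ∧ z = ∑ i, a i * x ^ (i : ℕ) := by
  classical
  have := Fintype.ofFinite W
  have hle (a : Fin (Nat.card W) → L) (ha : ∀ i (σ : W), σ • a i = a i) (i : Fin (Nat.card W)) :
      v (a i * x ^ (i : ℕ)) ≤ v (∑ i, a i * x ^ (i : ℕ)) := by
    refine v.map_le_map_sum_of_pairwise_ne _ (fun i : Fin (Nat.card W) => a i * x ^ (i : ℕ))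
      (fun i _ j _ hij hi0 => ?_) (Finset.mem_univ i)
    have hx0 : x ≠ 0 := (v.ne_zero_iff).1 (by simp [hx])
    have hai : a i ≠ 0 := left_ne_zero_of_mul hi0
    obtain ⟨k, hk⟩ := hF _ hai (ha i)
    rcases eq_or_ne (a j) 0 with haj | haj
    · simpa [haj] using And.intro hai (fun h => absurd h hx0)
    obtain ⟨l, hl⟩ := hF _ haj (ha j)
    simp only [map_mul, map_pow, hk, hl, hx]
    exact exp_mul_sub_ne i.2 j.2 (fun h => hij (Fin.ext h)) k l
  have hx0 : x ≠ 0 := (v.ne_zero_iff).1 (by simp [hx])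
  have hli : LinearIndependent (FixedPoints.subfield W L)
      (fun i : Fin (Nat.card W) => x ^ (i : ℕ)) := by
    rw [Fintype.linearIndependent_iff]
    intro g hg i
    have := hle (fun i => (g i : L)) (fun i σ => (g i).2 σ) i
    have h2 : ∑ i, (g i : L) * x ^ (i : ℕ) = 0 := by
      rw [← hg]; rfl
    rw [h2, map_zero, le_zero_iff, v.zero_iff, mul_eq_zero] at this
    exact Subtype.ext (this.resolve_right (pow_ne_zero _ hx0))
  have hcard : Fintype.card (Fin (Nat.card W)) =
      Module.finrank (FixedPoints.subfield W L) L := by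
    rw [FixedPoints.finrank_eq_card, Fintype.card_fin, Nat.card_eq_fintype_card]
  have : Nonempty (Fin (Nat.card W)) := ⟨⟨0, Nat.card_pos⟩⟩
  let b := basisOfLinearIndependentOfCardEqFinrank hli hcard
  have hz : z = ∑ i, (b.repr z i : L) * x ^ (i : ℕ) := by
    conv_lhs => rw [← b.sum_repr z]
    refine Finset.sum_congr rfl fun i _ => ?_
    rw [coe_basisOfLinearIndependentOfCardEqFinrank]
    rfl
  refine ⟨fun i => (b.repr z i : L), fun i σ => (b.repr z i).2 σ, fun hvz i => ?_, hz⟩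
  have h1 := (hle (fun i => (b.repr z i : L)) (fun i σ => (b.repr z i).2 σ) i).trans
    (hz ▸ hvz)
  change v (b.repr z i : L) ≤ 1
  generalize hc : (b.repr z i : L) = c at h1 ⊢
  rcases eq_or_ne c 0 with h0 | h0
  · simp [h0]
  obtain ⟨k, hk⟩ := hF c h0 (fun σ => hc ▸ (b.repr z i).2 σ)
  rw [map_mul, map_pow, hk, hx, ← exp_nsmul, ← exp_add, ← exp_zero, exp_le_exp] at h1
  rw [hk, ← exp_zero, exp_le_exp]
  simp only [nsmul_eq_mul] at h1
  have hi : (i : ℤ) < Nat.card W := by exact_mod_cast i.2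
  -- `|W| * k ≤ i < |W|` leaves no positive `k`.
  have : k ≤ 0 := by
    by_contra! hk0
    nlinarith
  nlinarith

theorem smul_uniformizer_injective [FaithfulSMul W L] (v : Valuation L ℤᵐ⁰)
    (hF : ∀ z : L, z ≠ 0 → (∀ σ : W, σ • z = z) → ∃ k : ℤ, v z = exp ((Nat.card W : ℤ) * k))
    {x : L} (hx : v x = exp (-1 : ℤ)) : Function.Injective (fun σ : W => σ • x) := by
  intro σ τ h
  refine FaithfulSMul.eq_of_smul_eq_smul (α := L) fun z => ?_
  obtain ⟨a, ha, -, rfl⟩ := exists_fixed_expansion v hF hx z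
  simp only at h
  simp [Finset.smul_sum, smul_mul', ha, smul_pow', h]

theorem Polynomial.valuation_eval_le_prod {Γ ι : Type*} [LinearOrderedCommGroupWithZero Γ]
    (v : Valuation L Γ) (G : v.integer[X]) (s : Finset ι) (r : ι → v.integer)
    (hr : Set.InjOn r s) (hroot : ∀ i ∈ s, G.eval (r i) = 0) (x : v.integer) :
    v (G.eval x : v.integer) ≤ ∏ i ∈ s, v (x - r i) := by
  classical
  rcases eq_or_ne G 0 with rfl | hG
  · simp
  have hdvd : (∏ i ∈ s, (X - C (r i))) ∣ G := by
    have h1 : (s.val.map r) ≤ G.roots := by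
      rw [Multiset.le_iff_subset (Multiset.Nodup.map_on (fun i hi j hj => hr hi hj) s.nodup)]
      intro a ha
      obtain ⟨i, hi, rfl⟩ := Multiset.mem_map.1 ha
      exact (mem_roots hG).2 (hroot i hi)
    have := (Multiset.prod_X_sub_C_dvd_iff_le_roots hG _).2 h1
    simpa [Multiset.map_map] using this
  obtain ⟨q, rfl⟩ := hdvd
  rw [eval_mul, eval_prod]
  push_cast
  rw [map_mul, map_prod]
  simp only [eval_sub, eval_X, eval_C, AddSubgroupClass.coe_sub]
  exact mul_le_of_le_one_right' (eval x q).2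

open Finset in
-- This compares ramification in a quotient with that in `W`. Write the `H`-norm `y` of `x` as
-- `g(x)` with fixed integral coefficients. Then `g - s • y` vanishes at every `(s * h) • x`, so it
-- is divisible by the product of the corresponding linear factors; evaluate at `x`.
theorem valuation_smul_prod_sub_le [Fintype W] [FaithfulSMul W L] (v : Valuation L ℤᵐ⁰)
    (hv : ∀ (σ : W) z, v (σ • z) = v z)
    (hF : ∀ z : L, z ≠ 0 → (∀ σ : W, σ • z = z) → ∃ k : ℤ, v z = exp ((Nat.card W : ℤ) * k))
    {x : L} (hx : v x = exp (-1 : ℤ)) (H : Subgroup W) [Fintype H] (s : W) :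
    v (s • (∏ h : H, (h : W) • x) - ∏ h : H, (h : W) • x) ≤
      ∏ h : H, v ((s * (h : W)) • x - x) := by
  have hx1 : v x ≤ 1 := by rw [hx, ← exp_zero, exp_le_exp]; omega
  set y := ∏ h : H, (h : W) • x with hy
  have hHy (h : H) : (h : W) • y = y := by
    rw [hy, smul_prod']
    exact Fintype.prod_equiv (Equiv.mulLeft h) _ _ fun g => by simp [smul_smul]
  have hy1 : v y ≤ 1 := by
    rw [hy, map_prod]
    exact prod_le_one' fun h _ => by rw [hv]; exact hx1
  obtain ⟨a, ha, ha1, hya⟩ := exists_fixed_expansion v hF hx y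
  let a' : Fin (Nat.card W) → v.integer := fun i => ⟨a i, ha1 hy1 i⟩
  let G : v.integer[X] := ∑ i, C (a' i) * X ^ (i : ℕ) - C ⟨s • y, by
    change v _ ≤ 1; rw [hv]; exact hy1⟩
  have hG (z : v.integer) : ((G.eval z : v.integer) : L) = ∑ i, a i * (z : L) ^ (i : ℕ) - s • y := by
    simp [G, eval_finsetSum, a']
  have hint (σ : W) : v (σ • x) ≤ 1 := by rw [hv]; exact hx1
  have key := Polynomial.valuation_eval_le_prod v G (univ : Finset H)
    (fun h => ⟨(s * (h : W)) • x, hint _⟩) ?_ ?_ ⟨x, hx1⟩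
  · rw [hG] at key
    simp only [← hya] at key
    rw [Valuation.map_sub_swap] at key
    refine key.trans (le_of_eq (prod_congr rfl fun h _ => ?_))
    rw [Valuation.map_sub_swap]
  · intro h _ h' _ heq
    simpa using smul_uniformizer_injective v hF hx (congrArg Subtype.val heq)
  · intro h _
    apply Subtype.ext
    rw [hG]
    have := congrArg (fun z => (s * (h : W)) • z) hya
    simp only [smul_sum, smul_mul', ha, smul_pow'] at this
    simp only [← this]
    rw [mul_smul, hHy, sub_self]
    rfl

end ValuationExpansion

/-! ### Cubic layers and averaging over characters. -/

section ElementaryAbelian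

open WithZero Finset

variable {L W : Type*} [Field L] [CommGroup W] [Fintype W] [MulSemiringAction W L]

theorem prod_coset_ker_eq {A M : Type*} [Group A] [DecidableEq A] [CommMonoid M]
    (φ : W →* A) [Fintype φ.ker] (s : W) (f : W → M) :
    ∏ h : φ.ker, f (s * (h : W)) = ∏ σ with φ σ = φ s, f σ := by
  refine prod_bij (fun h _ => s * (h : W)) (fun h _ => ?_) (fun h _ h' _ e => ?_)
    (fun σ hσ => ?_) (fun h _ => rfl)
  · have : φ (h : W) = 1 := h.2
    simp [this]
  · simpa using e
  · refine ⟨⟨s⁻¹ * σ, ?_⟩, mem_univ _, by simp⟩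
    simp only [mem_filter, mem_univ, true_and] at hσ
    simp [MonoidHom.mem_ker, hσ]

theorem zmod_three_cases (a : ZMod 3) : a = 0 ∨ a = 1 ∨ a = 2 := by
  revert a; decide

/-- In an index three quotient of a totally ramified group, the different of the corresponding
cubic extension is bounded by the valuation of `3 * y ^ 2`, where `y` is a uniformizer. -/
theorem exp_le_prod_valuation_of_surjective [FaithfulSMul W L] (v : Valuation L ℤᵐ⁰)
    (hv : ∀ (σ : W) z, v (σ • z) = v z)
    (hF : ∀ z : L, z ≠ 0 → (∀ σ : W, σ • z = z) → ∃ k : ℤ, v z = exp ((Nat.card W : ℤ) * k))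
    {x : L} (hx : v x = exp (-1 : ℤ)) {k n : ℕ} (h3 : v 3 = exp (-(Nat.card W * k : ℤ)))
    (φ : W →* Multiplicative (ZMod 3)) (hφ : Function.Surjective φ)
    (hn : Nat.card W = 3 * n) :
    (exp (-(n * (3 * k + 2) : ℤ)) : ℤᵐ⁰) ≤ ∏ σ with φ σ ≠ 1, v (σ • x - x) := by
  classical
  obtain ⟨s, hs⟩ := hφ (Multiplicative.ofAdd 1)
  have hs2 : φ (s * s) = Multiplicative.ofAdd 2 := by rw [map_mul, hs]; rfl
  have hs3 : φ (s * (s * s)) = 1 := by rw [map_mul, hs2, hs]; rfl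
  have hcases (σ : W) : φ σ = 1 ∨ φ σ = φ s ∨ φ σ = φ (s * s) := by
    rw [hs, hs2]; exact zmod_three_cases (φ σ).toAdd
  set y := ∏ h : φ.ker, (h : W) • x with hy
  have hker (σ : W) (h : φ σ = 1) : σ • y = y := by
    rw [hy, smul_prod']
    exact Fintype.prod_equiv (Equiv.mulLeft (⟨σ, h⟩ : φ.ker)) _ _ fun g => by simp [smul_smul]
  have hsmul (σ τ : W) (h : φ σ = φ τ) : σ • y = τ • y := by
    have := hker (τ⁻¹ * σ) (by simp [h])
    rw [mul_smul, inv_smul_eq_iff] at this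
    exact this
  have hcardker : Fintype.card φ.ker = n := by
    have h1 := φ.ker.card_mul_index
    rw [Subgroup.index_ker, MonoidHom.range_eq_top.2 hφ, Nat.card_congr Subgroup.topEquiv.toEquiv,
      Nat.card_congr Multiplicative.toAdd, Nat.card_zmod, hn, Nat.card_eq_fintype_card] at h1
    omega
  have hvy : v y = exp (-(n : ℤ)) := by
    rw [hy, map_prod]
    simp only [hv, hx, prod_const, card_univ, hcardker]
    rw [← exp_nsmul]; simp
  set y1 := s • y with hy1
  set y2 := (s * s) • y with hy2
  -- The kernel and `s` generate `W`, as the index is three.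
  have hfix (S : L) (h1 : ∀ σ : W, φ σ = 1 → σ • S = S) (h2 : s • S = S) (σ : W) :
      σ • S = S := by
    rcases hcases σ with h | h | h
    · exact h1 σ h
    · have := h1 (s⁻¹ * σ) (by simp [h])
      rw [mul_smul, inv_smul_eq_iff, h2] at this
      exact this
    · have := h1 (s⁻¹ * (s⁻¹ * σ)) (by simp [h])
      rw [mul_smul, inv_smul_eq_iff, mul_smul, inv_smul_eq_iff, h2, h2] at this
      exact this
  have hk1 (σ : W) (h : φ σ = 1) : σ • y1 = y1 := by
    rw [hy1, smul_smul]; exact hsmul _ _ (by simp [h])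
  have hk2 (σ : W) (h : φ σ = 1) : σ • y2 = y2 := by
    rw [hy2, smul_smul]; exact hsmul _ _ (by simp [h])
  have hsy1 : s • y1 = y2 := by rw [hy1, hy2, smul_smul]
  have hsy2 : s • y2 = y := by rw [hy2, smul_smul]; exact hker _ hs3
  have hvfix (z : L) (hz : z ≠ 0) (S1 : ∀ σ : W, φ σ = 1 → σ • z = z) (S2 : s • z = z) :
      ∃ k : ℤ, v z = exp (((3 * n : ℕ) : ℤ) * k) := hn ▸ hF z hz (hfix z S1 S2)
  -- the terms of `f' (y)`, for `f` the cubic polynomial with roots `y`, `y1`, `y2`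
  let t : Fin 3 → L := ![y * y1 + y * y2 + y1 * y2, -(2 * (y + y1 + y2)) * y, 3 * y ^ 2]
  have ht : ∑ i, t i = (y1 - y) * (y2 - y) := by
    simp [t, Fin.sum_univ_three]; ring
  -- The coefficient of `y ^ i` is `W`-fixed, so its valuation is a multiple of `3 * n`, while `y ^
  -- i` adds `n * i`: the three terms have distinct valuations and none exceeds the sum.
  have hform (i : Fin 3) (hi : t i ≠ 0) :
      ∃ l : ℤ, v (t i) = exp (-(3 * n : ℤ) * l - n * (i : ℕ)) := by
    fin_cases i
    · obtain ⟨l, hl⟩ := hvfix (y * y1 + y * y2 + y1 * y2) hi (fun σ h => by simp [smul_add, smul_mul', hker σ h, hk1 σ h,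
        hk2 σ h]) (by simp [smul_add, smul_mul', ← hy1, hsy1, hsy2]; ring)
      refine ⟨-l, ?_⟩
      change v (y * y1 + y * y2 + y1 * y2) = _
      rw [hl, exp_inj]; push_cast; simp
    · have hi' : -(2 * (y + y1 + y2)) ≠ 0 := left_ne_zero_of_mul hi
      obtain ⟨l, hl⟩ := hvfix _ hi' (fun σ h => by
        simp [smul_add, smul_neg, hker σ h, hk1 σ h, hk2 σ h, two_mul])
        (by simp [smul_add, smul_neg, ← hy1, hsy1, hsy2, two_mul]; ring)
      refine ⟨-l, ?_⟩
      change v (-(2 * (y + y1 + y2)) * y) = _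
      rw [map_mul, hl, hvy, ← exp_add, exp_inj]; push_cast; simp; ring
    · refine ⟨k, ?_⟩
      change v (3 * y ^ 2) = _
      rw [map_mul, map_pow, h3, hvy, ← exp_nsmul, ← exp_add, exp_inj, hn]; push_cast; simp; ring
  have hn0 : 0 < n := by
    have : 0 < Nat.card W := Nat.card_pos
    omega
  have hle : v (t 2) ≤ v ((y1 - y) * (y2 - y)) := by
    rw [← ht]
    refine v.map_le_map_sum_of_pairwise_ne univ t (fun i _ j _ hij hi => ?_) (mem_univ 2)
    obtain ⟨l, hl⟩ := hform i hi
    rcases eq_or_ne (t j) 0 with hj | hj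
    · rw [hj, map_zero]; exact v.ne_zero_iff.2 hi
    obtain ⟨l', hl'⟩ := hform j hj
    rw [hl, hl', Ne, exp_inj]
    intro e
    have e2 : (n : ℤ) * (3 * l + (i : ℕ)) = n * (3 * l' + (j : ℕ)) := by linarith
    have e3 := mul_left_cancel₀ (by exact_mod_cast hn0.ne') e2
    exact hij (Fin.ext (by omega))
  have hv2 : v (t 2) = exp (-(n * (3 * k + 2) : ℤ)) := by
    change v (3 * y ^ 2) = _
    rw [map_mul, map_pow, h3, hvy, ← exp_nsmul, ← exp_add, exp_inj, hn]; push_cast; simp; ring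
  rw [← hv2]
  refine hle.trans ?_
  rw [map_mul]
  refine (mul_le_mul' (valuation_smul_prod_sub_le v hv hF hx φ.ker s)
    (valuation_smul_prod_sub_le v hv hF hx φ.ker (s * s))).trans (le_of_eq ?_)
  -- The two nontrivial cosets of the kernel together make up `φ σ ≠ 1`.
  rw [prod_coset_ker_eq φ s (fun σ => v (σ • x - x)),
    prod_coset_ker_eq φ (s * s) (fun σ => v (σ • x - x)), ← prod_union]
  · refine prod_congr ?_ fun _ _ => rfl
    ext σ
    simp only [mem_union, mem_filter, mem_univ, true_and]
    constructor
    · rintro (h | h) <;> rw [h]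
      · rw [hs]; decide
      · rw [hs2]; decide
    · intro h
      exact (hcases σ).resolve_left h
  · rw [disjoint_filter]
    intro σ _ h1 h2
    rw [h1, hs, hs2] at h2
    revert h2; decide

open Module in
theorem three_mul_card_filter_ne_zero {V : Type*} [AddCommGroup V] [Module (ZMod 3) V] [Fintype V]
    (f : V →ₗ[ZMod 3] ZMod 3) (hf : f ≠ 0) :
    3 * #{v | f v ≠ 0} = 2 * Fintype.card V := by
  classical
  have h1 := f.toAddMonoidHom.ker.card_mul_index
  have hs : Function.Surjective f := LinearMap.surjective hf
  rw [AddSubgroup.index_ker, AddMonoidHom.range_eq_top.2 hs,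
    Nat.card_congr AddSubgroup.topEquiv.toEquiv, Nat.card_zmod, Nat.card_eq_fintype_card,
    Nat.card_eq_fintype_card] at h1
  have h2 : Fintype.card f.toAddMonoidHom.ker = #{v | f v = 0} := by
    rw [Fintype.card_subtype]
    exact congrArg card (filter_congr fun _ _ => Iff.rfl)
  have h3 := card_filter_add_card_filter_not (s := (univ : Finset V)) (fun v => f v = 0)
  rw [card_univ] at h3
  change _ + #{v | f v ≠ 0} = _ at h3
  omega

open Module in
-- Double counting over the `|W| - 1` nonzero functionals on the `𝔽₃`-space `W`: each `σ ≠ 1` is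
-- moved off zero by two thirds of the dual. This plays the role of the conductor-discriminant
-- formula.
theorem two_mul_card_mul_sum_le (hW : ∀ σ : W, σ ^ 3 = 1) [DecidableEq W] (f : W → ℤ) (B : ℤ)
    (h : ∀ φ : W →* Multiplicative (ZMod 3), Function.Surjective φ →
      3 * ∑ σ with φ σ ≠ 1, f σ ≤ B) :
    2 * Fintype.card W * ∑ σ with σ ≠ 1, f σ ≤ (Fintype.card W - 1) * B := by
  classical
  let _ : Module (ZMod 3) (Additive W) := AddCommGroup.zmodModule fun σ => hW σ.toMul
  let _ : Fintype (Dual (ZMod 3) (Additive W)) := @Fintype.ofFinite _ (Module.finite_of_finite (ZMod 3))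
  have hcard : Fintype.card (Dual (ZMod 3) (Additive W)) = Fintype.card W := by
    rw [Module.card_eq_pow_finrank (K := ZMod 3), Subspace.dual_finrank_eq,
      ← Module.card_eq_pow_finrank (K := ZMod 3) (V := Additive W)]
    exact Fintype.card_congr Additive.toMul
  have h1 (φ : Dual (ZMod 3) (Additive W)) (hφ : φ ≠ 0) :
      3 * ∑ σ with φ (Additive.ofMul σ) ≠ 0, f σ ≤ B :=
    h (AddMonoidHom.toMultiplicativeRight φ.toAddMonoidHom) fun a => by
      obtain ⟨w, hw⟩ := LinearMap.surjective hφ a.toAdd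
      exact ⟨w.toMul, hw⟩
  have h2 (σ : W) (hσ : σ ≠ 1) :
      3 * #{φ : Dual (ZMod 3) (Additive W) | φ (Additive.ofMul σ) ≠ 0} = 2 * Fintype.card W := by
    rw [← hcard]
    refine three_mul_card_filter_ne_zero (Dual.eval (ZMod 3) (Additive W) (Additive.ofMul σ)) ?_
    rw [Ne, Module.eval_apply_eq_zero_iff]
    exact hσ
  have h3 : ∑ φ : Dual (ZMod 3) (Additive W) with φ ≠ 0,
      3 * ∑ σ with φ (Additive.ofMul σ) ≠ 0, f σ ≤ (Fintype.card W - 1) * B := by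
    refine (sum_le_card_nsmul _ _ B fun φ hφ => h1 φ (by simpa using hφ)).trans (le_of_eq ?_)
    rw [filter_ne', card_erase_of_mem (mem_univ _), card_univ, hcard, nsmul_eq_mul,
      Nat.cast_sub Fintype.card_pos, Nat.cast_one]
  refine le_trans (le_of_eq ?_) h3
  have h4 : ∑ φ : Dual (ZMod 3) (Additive W) with φ ≠ 0,
      3 * ∑ σ with φ (Additive.ofMul σ) ≠ 0, f σ =
      ∑ φ : Dual (ZMod 3) (Additive W), ∑ σ : W,
        if φ (Additive.ofMul σ) ≠ 0 then 3 * f σ else 0 := by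
    rw [sum_filter]
    refine sum_congr rfl fun φ _ => ?_
    split_ifs with h0
    · rw [mul_sum, sum_filter]
    · rw [not_not] at h0; simp [h0]
  rw [h4, sum_comm, mul_sum, sum_filter]
  refine sum_congr rfl fun σ _ => ?_
  split_ifs with h0
  · rw [← sum_filter, sum_const, nsmul_eq_mul]
    have := h2 σ h0
    zify at this
    rw [← this]; ring
  · rw [not_not] at h0
    simp [h0]

theorem log_finset_prod {ι : Type*} {s : Finset ι} {f : ι → ℤᵐ⁰} (h : ∀ i ∈ s, f i ≠ 0) :
    log (∏ i ∈ s, f i) = ∑ i ∈ s, log (f i) := by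
  classical
  induction s using Finset.induction_on with
  | empty => simp
  | insert a s ha ih =>
    have h' : ∀ i ∈ s, f i ≠ 0 := fun i hi => h i (mem_insert_of_mem hi)
    rw [prod_insert ha, sum_insert ha, log_mul (h a (mem_insert_self a s))
      (prod_ne_zero_iff.2 h'), ih h']

theorem two_mul_sum_log_valuation_le [FaithfulSMul W L] [DecidableEq W] (hW : ∀ σ : W, σ ^ 3 = 1)
    (v : Valuation L ℤᵐ⁰) (hv : ∀ (σ : W) z, v (σ • z) = v z)
    (hF : ∀ z : L, z ≠ 0 → (∀ σ : W, σ • z = z) → ∃ k : ℤ, v z = exp ((Nat.card W : ℤ) * k))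
    {x : L} (hx : v x = exp (-1 : ℤ)) {k : ℕ} (h3 : v 3 = exp (-(Nat.card W * k : ℤ))) :
    2 * ∑ σ : W with σ ≠ 1, -log (v (σ • x - x)) ≤ (Nat.card W - 1) * (3 * k + 2 : ℤ) := by
  have hpos : 0 < Nat.card W := Nat.card_pos
  have key := two_mul_card_mul_sum_le hW (fun σ => -log (v (σ • x - x)))
    (Nat.card W * (3 * k + 2 : ℤ)) fun φ hφ => ?_
  · rw [← Nat.card_eq_fintype_card] at key
    have hpos' : (0 : ℤ) < Nat.card W := by exact_mod_cast hpos
    refine le_of_mul_le_mul_left ?_ hpos'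
    linarith
  · have h1 := φ.ker.card_mul_index
    rw [Subgroup.index_ker, MonoidHom.range_eq_top.2 hφ, Nat.card_congr Subgroup.topEquiv.toEquiv,
      Nat.card_congr Multiplicative.toAdd, Nat.card_zmod] at h1
    have h2 := exp_le_prod_valuation_of_surjective v hv hF hx h3 φ hφ (n := Nat.card φ.ker)
      (by omega)
    have h0 (σ : W) (hσ : σ ∈ ({σ | φ σ ≠ 1} : Finset W)) : v (σ • x - x) ≠ 0 := by
      rw [v.ne_zero_iff, sub_ne_zero]
      intro e
      have : σ = 1 := smul_uniformizer_injective v hF hx (by simpa using e)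
      simp [this] at hσ
    rw [← le_log_iff_exp_le (prod_ne_zero_iff.2 h0), log_finset_prod h0] at h2
    rw [sum_neg_distrib, ← h1]
    push_cast
    linarith

end ElementaryAbelian

/-! ### Finite `p`-subgroups of `GL₂` in characteristic `p`. -/

section UnipotentSubgroups

open Matrix

/-- In a basis starting with `u` both matrices are strictly upper triangular. -/
theorem Matrix.mul_eq_zero_of_trace_eq_zero {F : Type*} [Field F] {A B : Matrix (Fin 2) (Fin 2) F}
    {u : Fin 2 → F} (hu : u ≠ 0) (hA : A *ᵥ u = 0) (hB : B *ᵥ u = 0) (htA : A.trace = 0)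
    (htB : B.trace = 0) : A * B = 0 := by
  have a0 := congrFun hA 0
  have a1 := congrFun hA 1
  have b0 := congrFun hB 0
  have b1 := congrFun hB 1
  simp only [mulVec, dotProduct, Fin.sum_univ_two, Pi.zero_apply] at a0 a1 b0 b1
  rw [trace_fin_two] at htA htB
  have hA1 : A 1 1 = - A 0 0 := by linear_combination htA
  have hB1 : B 1 1 = - B 0 0 := by linear_combination htB
  rw [hA1] at a1
  rw [hB1] at b1
  by_cases h0 : u 0 = 0
  · have h1 : u 1 ≠ 0 := fun h1 => hu (by ext i; fin_cases i <;> simpa)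
    have e1 : A 0 1 = 0 := by simpa [h0, h1] using a0
    have e2 : A 0 0 = 0 := by simpa [h0, h1] using a1
    have e3 : B 0 1 = 0 := by simpa [h0, h1] using b0
    have e4 : B 0 0 = 0 := by simpa [h0, h1] using b1
    ext i j
    fin_cases i <;> fin_cases j <;> simp [mul_apply, Fin.sum_univ_two, *]
  · have e1 : A 0 0 = - (u 1 / u 0) * A 0 1 := by field_simp; linear_combination a0
    have e2 : A 1 0 = - (u 1 / u 0) ^ 2 * A 0 1 := by
      have : A 1 0 = A 0 0 * (u 1 / u 0) := by field_simp; linear_combination a1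
      rw [this, e1]; ring
    have e3 : B 0 0 = - (u 1 / u 0) * B 0 1 := by field_simp; linear_combination b0
    have e4 : B 1 0 = - (u 1 / u 0) ^ 2 * B 0 1 := by
      have : B 1 0 = B 0 0 * (u 1 / u 0) := by field_simp; linear_combination b1
      rw [this, e3]; ring
    ext i j
    fin_cases i <;> fin_cases j <;>
      simp only [mul_apply, Fin.sum_univ_two, hA1, hB1, e1, e2, e3, e4, Fin.zero_eta, Fin.mk_one,
        zero_apply] <;> ring

/-- A finite `p`-group of invertible `2 × 2` matrices in characteristic `p` is commutative, and
of exponent `p`. -/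
theorem IsPGroup.commute_and_pow_eq_one_of_injective {F W : Type*} [Field F] [Finite F] [Group W]
    [Finite W] (p : ℕ) [Fact p.Prime] [CharP F p] (hW : IsPGroup p W) (ρ : W →* GL (Fin 2) F)
    (hρ : Function.Injective ρ) : (∀ g h : W, g * h = h * g) ∧ ∀ g : W, g ^ p = 1 := by
  classical
  let _ : MulAction W (Fin 2 → F) :=
    { smul := fun g u => (ρ g : Matrix (Fin 2) (Fin 2) F) *ᵥ u
      one_smul := fun u => by
        change (ρ 1 : Matrix (Fin 2) (Fin 2) F) *ᵥ u = u
        simp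
      mul_smul := fun g h u => by
        change (ρ (g * h) : Matrix (Fin 2) (Fin 2) F) *ᵥ u = (ρ g : Matrix (Fin 2) (Fin 2) F) *ᵥ
          ((ρ h : Matrix (Fin 2) (Fin 2) F) *ᵥ u)
        rw [map_mul, Units.val_mul, mulVec_mulVec] }
  have hsmul (g : W) (u : Fin 2 → F) : g • u = (ρ g : Matrix (Fin 2) (Fin 2) F) *ᵥ u := rfl
  have hdvd : p ∣ Nat.card (Fin 2 → F) := by
    have := Fintype.ofFinite F
    obtain ⟨n, hp, hn⟩ := FiniteField.card F p
    rw [Nat.card_eq_fintype_card, Fintype.card_fun, hn, Fintype.card_fin]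
    exact dvd_pow (dvd_pow_self p n.ne_zero) two_ne_zero
  -- The number of fixed vectors is divisible by `p`, and `0` is one of them, so a nonzero one
  -- exists.
  obtain ⟨u, hu, hu0⟩ := hW.exists_fixed_point_of_prime_dvd_card_of_fixed_point (Fin 2 → F) hdvd
    (a := 0) (fun g => by rw [hsmul, mulVec_zero])
  have hfix (g : W) : ((ρ g : Matrix (Fin 2) (Fin 2) F) - 1) *ᵥ u = 0 := by
    rw [sub_mulVec, one_mulVec, sub_eq_zero]; exact hu g
  have htr (g : W) : ((ρ g : Matrix (Fin 2) (Fin 2) F) - 1).trace = 0 := by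
    refine IsNilpotent.eq_zero (Matrix.isNilpotent_trace_of_isNilpotent ?_)
    obtain ⟨k, hk⟩ := hW g
    refine ⟨p ^ k, ?_⟩
    rw [sub_pow_char_pow_of_commute _ _ (Commute.one_right _), one_pow, sub_eq_zero,
      ← Units.val_pow_eq_pow_val, ← map_pow, hk, map_one, Units.val_one]
  have hmul (g h : W) := mul_eq_zero_of_trace_eq_zero hu0.symm (hfix g) (hfix h) (htr g) (htr h)
  -- Both `(g - 1) * (h - 1)` and `(h - 1) * (g - 1)` vanish, so `g * h = g + h - 1 = h * g`; and `g
  -- ^ p - 1 = (g - 1) ^ p = 0`.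
  refine ⟨fun g h => hρ (Units.ext ?_), fun g => hρ (Units.ext ?_)⟩
  · have h1 := hmul g h
    have h2 := hmul h g
    rw [map_mul, map_mul, Units.val_mul, Units.val_mul]
    rw [sub_mul, mul_sub, mul_sub] at h1 h2
    simp only [mul_one, one_mul] at h1 h2
    rw [← sub_eq_zero]
    have h3 := congrArg₂ (· - ·) h1 h2
    simp only [sub_zero] at h3
    rw [← h3]; abel
  · have h1 : ((ρ g : Matrix (Fin 2) (Fin 2) F) - 1) ^ p = 0 := by
      rw [← Nat.sub_add_cancel (Fact.out : p.Prime).two_le, pow_add, pow_two, hmul, mul_zero]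
    rw [sub_pow_char_of_commute _ (Commute.one_right _), one_pow, sub_eq_zero] at h1
    rw [map_pow, Units.val_pow_eq_pow_val, h1, map_one, Units.val_one]

end UnipotentSubgroups

/-! ### The different of a totally ramified elementary abelian extension. -/

section DifferentExponent

open WithZero Polynomial IsDedekindDomain Pointwise

theorem IsDedekindDomain.HeightOneSpectrum.valuation_smul_eq {W R L : Type*} [Group W] [CommRing R]
    [IsDedekindDomain R] [Field L] [Algebra R L] [IsFractionRing R L] [MulSemiringAction W R]
    [MulSemiringAction W L] [SMulDistribClass W R L] (v : HeightOneSpectrum R)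
    (h : ∀ σ : W, σ • v.asIdeal = v.asIdeal) (σ : W) (z : L) :
    v.valuation L (σ • z) = v.valuation L z := by
  have hle (τ : W) (r : R) : v.intValuation (τ • r) ≤ v.intValuation r := by
    rcases eq_or_ne r 0 with rfl | hr
    · simp
    rw [v.intValuation_eq_exp_neg_multiplicity hr, v.intValuation_le_pow_iff_mem]
    have h1 : r ∈ v.asIdeal ^ multiplicity v.asIdeal (Ideal.span {r}) := by
      rw [← Ideal.dvd_span_singleton]; exact pow_multiplicity_dvd _ _
    have h2 := Ideal.smul_mem_pointwise_smul τ _ _ h1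
    rwa [smul_pow', h] at h2
  have heq (τ : W) (r : R) : v.intValuation (τ • r) = v.intValuation r :=
    le_antisymm (hle τ r) (by simpa using hle τ⁻¹ (τ • r))
  obtain ⟨a, b, -, rfl⟩ := IsFractionRing.div_surjective (A := R) z
  rw [smul_div₀', ← algebraMap.smul', ← algebraMap.smul', map_div₀, map_div₀]
  simp only [HeightOneSpectrum.valuation_of_algebraMap, heq]

variable {M L W : Type*} [Field M] [NumberField M] [Field L] [NumberField L] [Algebra M L]

theorem exists_valuation_eq_exp_ramificationIdx_mul (v : HeightOneSpectrum (𝓞 L)) (z : M)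
    (hz : z ≠ 0) : ∃ k : ℤ, v.valuation L (algebraMap M L z) =
      exp ((v.asIdeal.ramificationIdx (𝓞 M) : ℤ) * k) := by
  let q : HeightOneSpectrum (𝓞 M) := ⟨v.asIdeal.under (𝓞 M), inferInstance,
    mt Ideal.eq_bot_of_comap_eq_bot v.ne_bot⟩
  have : v.asIdeal.LiesOver q.asIdeal := Ideal.over_under _ 
  have h := HeightOneSpectrum.valuation_liesOver L q v z
  rw [Ideal.ramificationIdx'_eq_ramificationIdx _ _ q.ne_bot] at h
  have h0 : q.valuation M z ≠ 0 := (Valuation.ne_zero_iff _).2 hz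
  refine ⟨log (q.valuation M z), ?_⟩
  rw [← h, ← nsmul_eq_mul, exp_nsmul, exp_log h0]

theorem valuation_natCast_eq_exp_ramificationIdx {p : ℕ} (hp : p.Prime) (v : HeightOneSpectrum (𝓞 L))
    (h : (p : 𝓞 L) ∈ v.asIdeal) :
    v.valuation L (p : L) = exp (-(v.asIdeal.ramificationIdx ℤ : ℤ)) := by
  have hp' : Prime (p : ℤ) := Nat.prime_iff_prime_int.1 hp
  have hprime : (Ideal.span {(p : ℤ)}).IsPrime :=
    (Ideal.span_singleton_prime hp'.ne_zero).2 hp'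
  let q : HeightOneSpectrum ℤ := ⟨Ideal.span {(p : ℤ)}, hprime, by simpa using hp.ne_zero⟩
  have : v.asIdeal.LiesOver q.asIdeal := by
    refine ⟨(PrincipalIdealRing.isMaximal_of_irreducible hp'.irreducible).eq_of_le
      (Ideal.IsPrime.ne_top inferInstance) ?_⟩
    rw [Ideal.span_singleton_le_iff_mem, Ideal.under_def, Ideal.mem_comap]
    simpa using h
  have h1 := HeightOneSpectrum.valuation_liesOver L q v (p : ℚ)
  rw [Ideal.ramificationIdx'_eq_ramificationIdx _ _ q.ne_bot] at h1
  have h2 : q.valuation ℚ (p : ℚ) = exp (-1 : ℤ) := by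
    have := q.valuation_of_algebraMap (K := ℚ) (p : ℤ)
    rw [q.intValuation_singleton hp'.ne_zero rfl] at this
    simpa using this
  rw [h2] at h1
  rw [map_natCast] at h1
  rw [← h1, ← exp_nsmul]
  simp

theorem minpoly_map_eq_prod_of_smul_injective [Group W] [Fintype W] [MulSemiringAction W L]
    [IsGaloisGroup W M L] {x : L}
    (hinj : Function.Injective (fun σ : W => σ • x)) :
    (minpoly M x).map (algebraMap M L) = ∏ σ : W, (X - C (σ • x)) := by
  have hint : IsIntegral M x := Algebra.IsIntegral.isIntegral x
  have hmon := (minpoly.monic hint).map (algebraMap M L)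
  refine eq_of_monic_of_dvd_of_natDegree_le
    (monic_prod_of_monic _ _ fun σ _ => monic_X_sub_C _) hmon ?_ ?_
  · have h1 : (Finset.univ.val.map fun σ : W => σ • x) ≤
        ((minpoly M x).map (algebraMap M L)).roots := by
      rw [Multiset.le_iff_subset (Multiset.Nodup.map hinj Finset.univ.nodup)]
      intro a ha
      obtain ⟨σ, -, rfl⟩ := Multiset.mem_map.1 ha
      rw [mem_roots hmon.ne_zero, IsRoot.def, eval_map_algebraMap]
      have : SMulCommClass W M L := IsGaloisGroup.commutes
      have h2 := aeval_algHom_apply (MulSemiringAction.toAlgHom M L σ) x (minpoly M x)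
      rw [minpoly.aeval, map_zero] at h2
      exact h2
    have := (Multiset.prod_X_sub_C_dvd_iff_le_roots hmon.ne_zero _).2 h1
    simpa [Multiset.map_map] using this
  · rw [natDegree_map, natDegree_prod_of_monic _ _ fun σ _ => monic_X_sub_C _]
    simp only [natDegree_X_sub_C, Finset.sum_const, Finset.card_univ, smul_eq_mul, mul_one]
    rw [← Nat.card_eq_fintype_card, IsGaloisGroup.card_eq_finrank W M L]
    exact minpoly.natDegree_le x

/-- For a global integer `x` that is a uniformizer at `v`, with minimal polynomial `f`, the element
`f'(x) = ∏ (x - σ • x)` lies in the different, so its valuation bounds `b`. This needs only that `x`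
generates `L` over `M`, not that `𝓞 L` is monogenic. -/
theorem differentIdeal_exponent_le [CommGroup W] [Finite W] [MulSemiringAction W L]
    [IsGaloisGroup W M L] (hW : ∀ σ : W, σ ^ 3 = 1) (v : HeightOneSpectrum (𝓞 L))
    (h3 : (3 : 𝓞 L) ∈ v.asIdeal) (hst : ∀ σ : W, σ • v.asIdeal = v.asIdeal)
    (hram : v.asIdeal.ramificationIdx (𝓞 M) = Nat.card W) {k : ℕ}
    (hk : v.asIdeal.ramificationIdx ℤ = Nat.card W * k) {b : ℕ}
    (hb : v.asIdeal ^ b ∣ differentIdeal (𝓞 M) (𝓞 L)) :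
    (2 * b : ℤ) ≤ (Nat.card W - 1) * (3 * k + 2) := by
  classical
  have := Fintype.ofFinite W
  have hfaith : FaithfulSMul W L := IsGaloisGroup.faithful M
  have hcomm : SMulCommClass W M L := IsGaloisGroup.commutes
  have hvs := v.valuation_smul_eq (L := L) hst
  have hF (z : L) (hz : z ≠ 0) (hfix : ∀ σ : W, σ • z = z) :
      ∃ k : ℤ, v.valuation L z = exp ((Nat.card W : ℤ) * k) := by
    have hinv : Algebra.IsInvariant M L W := IsGaloisGroup.isInvariant
    obtain ⟨a, rfl⟩ := hinv.isInvariant z hfix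
    rw [← hram]
    exact exists_valuation_eq_exp_ramificationIdx_mul v a (by rintro rfl; simp at hz)
  obtain ⟨x, hx⟩ := v.intValuation_exists_uniformizer
  have hvx : v.valuation L (x : L) = exp (-1 : ℤ) := by
    rw [← hx]; exact v.valuation_of_algebraMap x
  have hinj := smul_uniformizer_injective (v.valuation L) hF hvx
  have hadj : Algebra.adjoin M {(x : L)} = ⊤ := by
    rw [eq_top_iff]
    rintro z -
    obtain ⟨a, ha, -, rfl⟩ := exists_fixed_expansion (v.valuation L) hF hvx z
    refine sum_mem fun i _ => mul_mem ?_ (pow_mem (Algebra.self_mem_adjoin_singleton M _) _)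
    have hinv : Algebra.IsInvariant M L W := IsGaloisGroup.isInvariant
    obtain ⟨c, hc⟩ := hinv.isInvariant (a i) (ha i)
    rw [← hc]
    exact Subalgebra.algebraMap_mem _ c
  have hmem := (Ideal.dvd_iff_le.1 hb) (aeval_derivative_mem_differentIdeal (𝓞 M) M L x hadj)
  rw [← v.intValuation_le_pow_iff_mem, ← v.valuation_of_algebraMap (K := L)] at hmem
  have hder : algebraMap (𝓞 L) L (aeval x (derivative (minpoly (𝓞 M) x))) =
      ∏ σ : W with σ ≠ 1, ((x : L) - σ • (x : L)) := by
    rw [← aeval_algebraMap_apply, ← aeval_map_algebraMap M, ← derivative_map,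
      ← minpoly.isIntegrallyClosed_eq_field_fractions M L (IsIntegralClosure.isIntegral (𝓞 M) L x),
      ← eval_map_algebraMap, ← derivative_map,
      minpoly_map_eq_prod_of_smul_injective (W := W) hinj, derivative_prod_finset, eval_finsetSum,
      Finset.sum_eq_single 1]
    · simp [eval_prod, Finset.filter_ne']
    · intro σ _ hσ
      rw [eval_mul, eval_prod, Finset.prod_eq_zero (i := 1)] <;> simp [hσ.symm]
    · simp
  have h3' := valuation_natCast_eq_exp_ramificationIdx Nat.prime_three v (by simpa using h3)
  have key := two_mul_sum_log_valuation_le hW (v.valuation L) hvs hF hvx (k := k) (by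
    rw [hk] at h3'; push_cast at h3'; exact h3')
  refine le_trans ?_ key
  have h0 (σ : W) (hσ : σ ∈ ({σ | σ ≠ 1} : Finset W)) :
      v.valuation L (σ • (x : L) - x) ≠ 0 := by
    rw [Valuation.ne_zero_iff, sub_ne_zero]
    intro e
    have : σ = 1 := hinj (by simpa using e)
    simp [this] at hσ
  change v.valuation L (algebraMap (𝓞 L) L _) ≤ _ at hmem
  rw [hder, map_prod] at hmem
  simp only [Valuation.map_sub_swap _ (x : L)] at hmem
  rw [← log_le_iff_le_exp (Finset.prod_ne_zero_iff.2 h0), log_finset_prod h0] at hmem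
  rw [Finset.sum_neg_distrib]
  linarith

end DifferentExponent

/-! ### Differents in towers; the tame part. -/

section DifferentTower

attribute [local instance] FractionRing.liftAlgebra

variable {T M L : Type*} [Field T] [NumberField T] [Field M] [NumberField M]
  [Field L] [NumberField L] [Algebra T M]

theorem emultiplicity_map_algebraMap_eq [Algebra M L] {I : Ideal (𝓞 M)} (hI : I ≠ ⊥)
    (P : Ideal (𝓞 M)) (Q : Ideal (𝓞 L)) [P.IsPrime] [Q.IsPrime] [Q.LiesOver P] (hP : P ≠ ⊥) :
    emultiplicity Q (I.map (algebraMap (𝓞 M) (𝓞 L))) =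
      Q.ramificationIdx (𝓞 M) * emultiplicity P I := by
  have hQ : Q ≠ ⊥ := Ideal.ne_bot_of_liesOver_of_ne_bot hP Q
  rw [← Ideal.ramificationIdx'_eq_ramificationIdx P Q hP]
  exact Ideal.IsDedekindDomain.emultiplicity_map_eq_ramificationIdx'_mul hI
    (Ideal.prime_of_isPrime hP inferInstance).irreducible
    (Ideal.prime_of_isPrime hQ inferInstance).irreducible hQ

/-- With `d` the degree and `p 𝓞_M = P ^ d * J`, norms give `N(p) ^ d = N(P) ^ d * N(J)`. As `N(p) ≤
N(P)`, the cofactor `J` is trivial. -/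
theorem pow_finrank_eq_map_of_ramificationIdx_eq (p : Ideal (𝓞 T)) (P : Ideal (𝓞 M))
    [p.IsPrime] [P.IsPrime] [P.LiesOver p] (hp : p ≠ ⊥)
    (h : P.ramificationIdx (𝓞 T) = Module.finrank T M) :
    P ^ Module.finrank T M = p.map (algebraMap (𝓞 T) (𝓞 M)) := by
  have hP : P ≠ ⊥ := Ideal.ne_bot_of_liesOver_of_ne_bot hp P
  have hp' : p.map (algebraMap (𝓞 T) (𝓞 M)) ≠ ⊥ := Ideal.map_ne_bot_of_ne_bot hp
  obtain ⟨J, hJ⟩ : P ^ Module.finrank T M ∣ p.map (algebraMap (𝓞 T) (𝓞 M)) := by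
    rw [← h, Ideal.IsDedekindDomain.ramificationIdx_eq_multiplicity p P hp']
    exact pow_multiplicity_dvd _ _
  have h1 := congrArg Ideal.absNorm hJ
  rw [map_mul, map_pow, Ideal.absNorm_algebraMap,
    ← IsFractionRing.finrank_eq (𝓞 T) T (𝓞 M) M] at h1
  have hfin : Finite (𝓞 M ⧸ P) := Ideal.finiteQuotientOfFreeOfNeBot P hP
  have hle : p.absNorm ≤ P.absNorm := by
    rw [Ideal.absNorm_apply, Ideal.absNorm_apply, Submodule.cardQuot_apply,
      Submodule.cardQuot_apply]
    exact Nat.card_le_card_of_injective (algebraMap (𝓞 T ⧸ p) (𝓞 M ⧸ P))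
      (FaithfulSMul.algebraMap_injective _ _)
  have hpos : 0 < P.absNorm := Nat.pos_of_ne_zero (by rwa [Ne, Ideal.absNorm_eq_zero_iff])
  have h2 : P.absNorm ^ Module.finrank T M * J.absNorm ≤ P.absNorm ^ Module.finrank T M * 1 := by
    rw [← h1, mul_one]; exact Nat.pow_le_pow_left hle _
  have h3 : J.absNorm ≤ 1 := le_of_mul_le_mul_left h2 (pow_pos hpos _)
  have h4 : J.absNorm ≠ 0 := by
    rw [Ne, Ideal.absNorm_eq_zero_iff]
    rintro rfl
    simp [hp'] at hJ
  have h5 : J = ⊤ := Ideal.absNorm_eq_one_iff.1 (by omega)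
  rw [hJ, h5, Ideal.mul_top]

/-- Divisibility would force all traces of integers into `p`, but the trace of `1` is the degree. -/
theorem not_pow_finrank_dvd_differentIdeal (p : Ideal (𝓞 T)) (P : Ideal (𝓞 M))
    [p.IsPrime] [P.IsPrime] [P.LiesOver p] (hp : p ≠ ⊥)
    (h : P.ramificationIdx (𝓞 T) = Module.finrank T M) (he : (Module.finrank T M : 𝓞 T) ∉ p) :
    ¬ P ^ Module.finrank T M ∣ differentIdeal (𝓞 T) (𝓞 M) := by
  refine not_dvd_differentIdeal_of_intTrace_not_mem (𝓞 T) (p := p) _ ⊤ ?_ 1 trivial ?_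
  · rw [Ideal.mul_top, pow_finrank_eq_map_of_ramificationIdx_eq p P hp h]
  · convert he
    apply FaithfulSMul.algebraMap_injective (𝓞 T) T
    rw [Algebra.algebraMap_intTrace (L := M), map_one, map_natCast]
    simpa using Algebra.trace_algebraMap (S := M) (1 : T)

theorem emultiplicity_differentIdeal_tower_le {K : Type*} [Field K] [NumberField K]
    [Algebra K T] [Algebra K M] [Algebra K L] [Algebra T L] [Algebra M L] [IsScalarTower K T M]
    [IsScalarTower K M L] [IsScalarTower K T L] [IsScalarTower T M L]
    (q : Ideal (𝓞 T)) (P : Ideal (𝓞 M)) (Q : Ideal (𝓞 L)) [q.IsPrime] [P.IsPrime] [Q.IsPrime]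
    [P.LiesOver q] [Q.LiesOver P] (hq : q ≠ ⊥) (hqK : q.ramificationIdx (𝓞 K) = 1)
    (h : P.ramificationIdx (𝓞 T) = Module.finrank T M) (he : (Module.finrank T M : 𝓞 T) ∉ q)
    {B : ℕ} (hB : emultiplicity Q (differentIdeal (𝓞 M) (𝓞 L)) ≤ B) :
    emultiplicity Q (differentIdeal (𝓞 K) (𝓞 L)) ≤
      (B + Q.ramificationIdx (𝓞 M) * (Module.finrank T M - 1) : ℕ) := by
  have hP : P ≠ ⊥ := Ideal.ne_bot_of_liesOver_of_ne_bot hq P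
  have hQ : Q ≠ ⊥ := Ideal.ne_bot_of_liesOver_of_ne_bot hP Q
  have hQ' : Prime Q := Ideal.prime_of_isPrime hQ inferInstance
  have : Q.LiesOver q := Ideal.LiesOver.trans Q P q
  have hunr : Algebra.IsUnramifiedAt (𝓞 K) q := Ideal.ramificationIdx_eq_one_iff.1 hqK
  rw [differentIdeal_eq_differentIdeal_mul_differentIdeal (𝓞 K) (𝓞 T) (𝓞 L),
    differentIdeal_eq_differentIdeal_mul_differentIdeal (𝓞 T) (𝓞 M) (𝓞 L),
    emultiplicity_mul hQ', emultiplicity_mul hQ',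
    emultiplicity_map_algebraMap_eq differentIdeal_ne_bot P Q hP,
    emultiplicity_map_algebraMap_eq differentIdeal_ne_bot q Q hq,
    emultiplicity_eq_zero.2 ((not_dvd_differentIdeal_iff).2 hunr), mul_zero, add_zero]
  have h1 : emultiplicity P (differentIdeal (𝓞 T) (𝓞 M)) ≤ (Module.finrank T M - 1 : ℕ) := by
    have := emultiplicity_lt_iff_not_dvd.2 (not_pow_finrank_dvd_differentIdeal q P hq h he)
    refine Order.le_of_lt_add_one (this.trans_le ?_)
    have : 0 < Module.finrank T M := Module.finrank_pos
    exact_mod_cast (by omega : Module.finrank T M ≤ Module.finrank T M - 1 + 1)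
  push_cast
  gcongr
  exact_mod_cast h1

end DifferentTower

/-! ### Exponent of the different via inertia and its Sylow subgroup. -/

section Inertia

open Pointwise

theorem ramificationIdx_eq_card_of_forall_smul_sub_mem {F L H : Type*} [Field F] [NumberField F]
    [Field L] [NumberField L] [Algebra F L] [Group H] [Finite H] [MulSemiringAction H L]
    [IsGaloisGroup H F L] (Q : Ideal (𝓞 L)) [Q.IsPrime] (hQ : Q ≠ ⊥)
    (h : ∀ (σ : H) (x : 𝓞 L), σ • x - x ∈ Q) : Q.ramificationIdx (𝓞 F) = Nat.card H := by
  have hq : Q.under (𝓞 F) ≠ ⊥ := mt Ideal.eq_bot_of_comap_eq_bot hQ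
  have : Finite (𝓞 F ⧸ Q.under (𝓞 F)) := Ideal.finiteQuotientOfFreeOfNeBot _ hq
  rw [← Ideal.ramificationIdxIn_eq_ramificationIdx (Q.under (𝓞 F)) Q H,
    ← Ideal.card_inertia_eq_ramificationIdxIn (G := H) (Q.under (𝓞 F)) Q,
    (eq_top_iff.2 fun σ _ => h σ : Q.inertia H = ⊤)]
  exact Nat.card_congr Subgroup.topEquiv.toEquiv

theorem emultiplicity_differentIdeal_le {K L : Type*} [Field K] [NumberField K] [Field L]
    [NumberField L] [Algebra K L] [IsGalois K L] {e m : ℕ} (he : e.Coprime 3)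
    (Q : Ideal (𝓞 L)) [hQp : Q.IsPrime] (h3 : (3 : 𝓞 L) ∈ Q)
    (hram : Q.ramificationIdx (𝓞 K) = e * 3 ^ m)
    (hramZ : Q.ramificationIdx ℤ = 2 * (e * 3 ^ m)) {F : Type*} [Field F] [Finite F] [CharP F 3]
    (ρ : Gal(L/K) →* GL (Fin 2) F) (hρ : Function.Injective ρ) :
    emultiplicity Q (differentIdeal (𝓞 K) (𝓞 L)) ≤
      ((3 ^ m - 1) * (3 * e + 1) + 3 ^ m * (e - 1) : ℕ) := by
  have hQ : Q ≠ ⊥ := by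
    rintro rfl
    exact (OfNat.ofNat_ne_zero 3 : (3 : 𝓞 L) ≠ 0) ((Submodule.mem_bot _).1 h3)
  have he0 : e ≠ 0 := by rintro rfl; norm_num at he
  set I := Q.inertia Gal(L/K) with hI
  have hcardI : Nat.card I = e * 3 ^ m := by
    have hq : Q.under (𝓞 K) ≠ ⊥ := mt Ideal.eq_bot_of_comap_eq_bot hQ
    have : Finite (𝓞 K ⧸ Q.under (𝓞 K)) := Ideal.finiteQuotientOfFreeOfNeBot _ hq
    rw [← hram, ← Ideal.ramificationIdxIn_eq_ramificationIdx (Q.under (𝓞 K)) Q Gal(L/K),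
      ← Ideal.card_inertia_eq_ramificationIdxIn (G := Gal(L/K)) (Q.under (𝓞 K)) Q]
  have : Fact (Nat.Prime 3) := ⟨Nat.prime_three⟩
  obtain ⟨W', hW'⟩ := Sylow.exists_subgroup_card_pow_prime (G := I) 3 (n := m)
    (hcardI ▸ Dvd.intro_left e rfl)
  set W : Subgroup Gal(L/K) := W'.map I.subtype with hW
  have hWI : W ≤ I := Subgroup.map_subtype_le W'
  have hcardW : Nat.card W = 3 ^ m := by
    rw [← hW']
    exact (Nat.card_congr (W'.equivMapOfInjective _ I.subtype_injective).toEquiv).symm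
  let T : IntermediateField K L := FixedPoints.intermediateField I
  let M : IntermediateField K L := FixedPoints.intermediateField W
  have hTM : T ≤ M := fun x hx σ => hx ⟨σ.1, hWI σ.2⟩
  have : IsGaloisGroup I T L := IsGaloisGroup.subgroup Gal(L/K) K L I
  have : IsGaloisGroup W M L := IsGaloisGroup.subgroup Gal(L/K) K L W
  let _ : Algebra T M := (IntermediateField.inclusion hTM).toAlgebra
  have : IsScalarTower K T M := IsScalarTower.of_algebraMap_eq' rfl
  have : IsScalarTower T M L := IsScalarTower.of_algebraMap_eq' rfl
  have hQT : Q.ramificationIdx (𝓞 T) = e * 3 ^ m := by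
    rw [← hcardI]
    exact ramificationIdx_eq_card_of_forall_smul_sub_mem Q hQ fun σ x => σ.2 x
  have hQM : Q.ramificationIdx (𝓞 M) = Nat.card W :=
    ramificationIdx_eq_card_of_forall_smul_sub_mem Q hQ fun σ x => hWI σ.2 x
  have hpos : 0 < 3 ^ m := by positivity
  have hq : Q.under (𝓞 T) ≠ ⊥ := mt Ideal.eq_bot_of_comap_eq_bot hQ
  have : (Q.under (𝓞 M)).LiesOver (Q.under (𝓞 T)) := inferInstance
  have hqK : (Q.under (𝓞 T)).ramificationIdx (𝓞 K) = 1 := by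
    have := Ideal.ramificationIdx_tower (R := 𝓞 K) (Q.under (𝓞 T)) Q
    rw [hram, hQT] at this
    exact Nat.eq_of_mul_eq_mul_right (Nat.mul_pos (Nat.pos_of_ne_zero he0) hpos)
      (this.symm.trans (one_mul _).symm)
  have hPT : (Q.under (𝓞 M)).ramificationIdx (𝓞 T) = e := by
    have := Ideal.ramificationIdx_tower (R := 𝓞 T) (Q.under (𝓞 M)) Q
    rw [hQT, hQM, hcardW] at this
    exact Nat.eq_of_mul_eq_mul_right hpos this.symm
  have hrank : Module.finrank T M = e := by
    have := Module.finrank_mul_finrank T M L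
    rw [← IsGaloisGroup.card_eq_finrank I T L, ← IsGaloisGroup.card_eq_finrank W M L, hcardI,
      hcardW] at this
    exact Nat.eq_of_mul_eq_mul_right hpos this
  have hnot : (Module.finrank T M : 𝓞 T) ∉ Q.under (𝓞 T) := by
    rw [hrank]
    intro hmem
    have h3' : (3 : 𝓞 T) ∈ Q.under (𝓞 T) := by
      rwa [Ideal.under_def, Ideal.mem_comap, map_ofNat]
    obtain ⟨a, b, hab⟩ := Nat.isCoprime_iff_coprime.2 he
    refine (inferInstance : (Q.under (𝓞 T)).IsPrime).ne_top ((Ideal.eq_top_iff_one _).2 ?_)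
    have := congrArg (Int.cast : ℤ → 𝓞 T) hab
    push_cast at this
    rw [← this]
    exact Ideal.add_mem _ (Ideal.mul_mem_left _ _ hmem) (Ideal.mul_mem_left _ _ h3')
  have key := emultiplicity_differentIdeal_tower_le (K := K) (Q.under (𝓞 T)) (Q.under (𝓞 M)) Q hq hqK
    (hPT.trans hrank.symm) hnot (B := (3 ^ m - 1) * (3 * e + 1)) ?_
  · rwa [hQM, hcardW, hrank] at key
  · obtain ⟨hcomm, hexp⟩ := IsPGroup.commute_and_pow_eq_one_of_injective 3
      (IsPGroup.of_card hcardW) (ρ.comp W.subtype) (hρ.comp W.subtype_injective)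
    let _ : CommGroup W := { (inferInstance : Group W) with mul_comm := hcomm }
    -- Testing against natural numbers `b` also rules out infinite multiplicity.
    refine ENat.forall_natCast_le_iff_le.1 fun b hb => ?_
    have hb' := pow_dvd_of_le_emultiplicity hb
    -- Here `k = 2 * e`, because `2 * (e * 3 ^ m) = |W| * (2 * e)`; halving `3 * k + 2` gives `3 * e
    -- + 1`.
    have := differentIdeal_exponent_le (M := M) (W := W) hexp ⟨Q, hQp, hQ⟩ h3
      (fun σ => Ideal.inertia_le_stabilizer Q (hWI σ.2)) hQM (k := 2 * e)
      (by rw [hramZ, hcardW]; ring) hb'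
    rw [hcardW] at this
    have h1 : b ≤ (3 ^ m - 1) * (3 * e + 1) := by
      zify [Nat.one_le_iff_ne_zero.2 hpos.ne']
      push_cast at this
      linarith
    exact_mod_cast h1

end Inertia

/-! ### A ramified prime in a quadratic field. -/

section RamifiedQuadratic

theorem quadratic_ramified {K : Type*} [Field K] [NumberField K] (hK : Module.finrank ℚ K = 2)
    {l : ℕ} (hl : l.Prime) (p : Ideal (𝓞 K)) [p.IsPrime] (hlp : (l : 𝓞 K) ∈ p)
    (hp : ¬ Algebra.IsUnramifiedAt ℤ p) :
    p.ramificationIdx ℤ = 2 ∧ p.absNorm = l ∧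
      ∀ (q : Ideal (𝓞 K)) [q.IsPrime], (l : 𝓞 K) ∈ q → q = p := by
  have hl' : Prime (l : ℤ) := Nat.prime_iff_prime_int.1 hl
  set s : Ideal ℤ := Ideal.span {(l : ℤ)} with hs
  have hs0 : s ≠ ⊥ := by simpa [hs] using hl.ne_zero
  have hmax : s.IsMaximal := PrincipalIdealRing.isMaximal_of_irreducible hl'.irreducible
  have hover (q : Ideal (𝓞 K)) [q.IsPrime] (hq : (l : 𝓞 K) ∈ q) : q.LiesOver s := by
    refine ⟨hmax.eq_of_le (Ideal.IsPrime.ne_top inferInstance) ?_⟩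
    rw [hs, Ideal.span_singleton_le_iff_mem, Ideal.under_def, Ideal.mem_comap]
    simpa using hq
  have := hover p hlp
  have : Finite (ℤ ⧸ p.under ℤ) := by
    rw [← Ideal.over_def p s]; exact Ideal.finiteQuotientOfFreeOfNeBot s hs0
  have he1 : p.ramificationIdx ℤ ≠ 1 := fun h => hp (Ideal.ramificationIdx_eq_one_iff.1 h)
  have he0 : 0 < p.ramificationIdx ℤ := p.ramificationIdx_pos ℤ
  have hf0 : 0 < p.inertiaDeg ℤ := p.inertiaDeg_pos ℤ
  have : Fintype (s.primesOver (𝓞 K)) := (Algebra.QuasiFinite.finite_primesOver s).fintype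
  have hsum := Ideal.sum_ramification_inertia_eq_finrank s (𝓞 K)
  rw [NumberField.RingOfIntegers.rank, hK] at hsum
  have hterm (q : s.primesOver (𝓞 K)) : 0 < q.1.ramificationIdx ℤ * q.1.inertiaDeg ℤ :=
    Nat.mul_pos (q.1.ramificationIdx_pos ℤ) (q.1.inertiaDeg_pos ℤ)
  let p' : s.primesOver (𝓞 K) := ⟨p, inferInstance, inferInstance⟩
  have hle : p.ramificationIdx ℤ * p.inertiaDeg ℤ ≤ 2 := hsum ▸
    Finset.single_le_sum (f := fun q : s.primesOver (𝓞 K) =>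
      q.1.ramificationIdx ℤ * q.1.inertiaDeg ℤ) (fun q _ => (hterm q).le) (Finset.mem_univ p')
  have he2 : p.ramificationIdx ℤ = 2 := by
    have := (Nat.le_mul_of_pos_right (p.ramificationIdx ℤ) hf0).trans hle
    omega
  have hf1 : p.inertiaDeg ℤ = 1 := by rw [he2] at hle; omega
  have hp0 : p ≠ ⊥ := Ideal.ne_bot_of_liesOver_of_ne_bot hs0 p
  have : p.IsMaximal := Ideal.IsPrime.isMaximal inferInstance hp0
  refine ⟨he2, ?_, fun q hq hlq => ?_⟩
  · rw [Ideal.absNorm_eq_pow_inertiaDeg' p hl, Ideal.inertiaDeg'_eq_inertiaDeg, hf1, pow_one]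
  · by_contra hne
    have := hover q hlq
    let q' : s.primesOver (𝓞 K) := ⟨q, inferInstance, inferInstance⟩
    have hne' : p' ≠ q' := fun h => hne (congrArg Subtype.val h).symm
    have h2 := Finset.add_le_sum (f := fun q : s.primesOver (𝓞 K) =>
      q.1.ramificationIdx ℤ * q.1.inertiaDeg ℤ) (fun q _ => (hterm q).le) (Finset.mem_univ p')
      (Finset.mem_univ q') hne'
    have h3 := hterm q'
    rw [hsum] at h2
    have h4 : p'.1.ramificationIdx ℤ * p'.1.inertiaDeg ℤ = 2 := by
      change p.ramificationIdx ℤ * p.inertiaDeg ℤ = 2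
      rw [he2, hf1]
    omega

end RamifiedQuadratic

/-! ### From local exponents to the discriminant. -/

section Discriminant

attribute [local instance] FractionRing.liftAlgebra

/-- Every `Q` over `p` has exponent `E` in `p 𝓞_L`, so the `E`-th power of the different divides `(p
𝓞_L) ^ B`. Raising to the power `E` avoids counting primes and residue degrees. -/
theorem absNorm_differentIdeal_pow_le {K L : Type*} [Field K] [NumberField K] [Field L]
    [NumberField L] [Algebra K L] [IsGalois K L] (p : Ideal (𝓞 K)) [p.IsPrime] (hp : p ≠ ⊥)
    {E B : ℕ} (hunr : ∀ (Q : Ideal (𝓞 L)) [Q.IsPrime], Q ≠ ⊥ → ¬ Q.LiesOver p →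
      Algebra.IsUnramifiedAt (𝓞 K) Q)
    (hram : ∀ (Q : Ideal (𝓞 L)) [Q.IsPrime] [Q.LiesOver p], Q.ramificationIdx (𝓞 K) = E)
    (hdiff : ∀ (Q : Ideal (𝓞 L)) [Q.IsPrime] [Q.LiesOver p],
      emultiplicity Q (differentIdeal (𝓞 K) (𝓞 L)) ≤ B) :
    (differentIdeal (𝓞 K) (𝓞 L)).absNorm ^ E ≤ (p.absNorm ^ Module.finrank K L) ^ B := by
  have hp' : p.map (algebraMap (𝓞 K) (𝓞 L)) ≠ ⊥ := Ideal.map_ne_bot_of_ne_bot hp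
  have hdvd : differentIdeal (𝓞 K) (𝓞 L) ^ E ∣ p.map (algebraMap (𝓞 K) (𝓞 L)) ^ B := by
    refine (UniqueFactorizationMonoid.dvd_iff_emultiplicity_le
      (pow_ne_zero _ differentIdeal_ne_bot)).2 fun Q hprime => ?_
    have hQ : Q ≠ ⊥ := hprime.ne_zero
    have : Q.IsPrime := Ideal.isPrime_of_prime hprime
    rw [emultiplicity_pow hprime, emultiplicity_pow hprime]
    by_cases hQp : Q.LiesOver p
    · rw [emultiplicity_map_algebraMap_eq hp p Q hp, hram Q,
        (FiniteMultiplicity.of_prime_left (Ideal.prime_of_isPrime hp inferInstance)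
          hp).emultiplicity_self, mul_one, mul_comm (B : ℕ∞)]
      gcongr
      exact hdiff Q
    · rw [emultiplicity_eq_zero.2 ((not_dvd_differentIdeal_iff).2 (hunr Q hQ hQp)), mul_zero]
      exact zero_le
  have h1 := Nat.le_of_dvd (Nat.pos_of_ne_zero (by
    rw [Ne, Ideal.absNorm_eq_zero_iff]; exact pow_ne_zero _ hp'))
    (Ideal.absNorm_dvd_absNorm_of_le (Ideal.le_of_dvd hdvd))
  rwa [map_pow, map_pow, Ideal.absNorm_algebraMap,
    ← IsFractionRing.finrank_eq (𝓞 K) K (𝓞 L) L] at h1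

end Discriminant

theorem proposition3 {K L : Type*} [Field K] [NumberField K] [Field L] [NumberField L]
    [Algebra K L] [IsGalois K L]
    -- `K` is a quadratic field in which `3` ramifies
    (hK : Module.finrank ℚ K = 2)
    (hK3 : ∃ (p : Ideal (𝓞 K)) (_ : p.IsPrime), (3 : 𝓞 K) ∈ p ∧ ¬ Algebra.IsUnramifiedAt ℤ p)
    (n : ℕ) (hn : Module.finrank K L = n)
    -- every finite prime of `L` not above `3` is unramified over `K`
    (hunr : ∀ (Q : Ideal (𝓞 L)) [Q.IsPrime], Q ≠ ⊥ → (3 : 𝓞 L) ∉ Q →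
      Algebra.IsUnramifiedAt (𝓞 K) Q)
    -- the ramification index of `L/K` at a prime `P` of `L` above `3` is `e * 3 ^ m`
    (e m : ℕ) (hm : 1 ≤ m) (he : e.Coprime 3)
    (P : Ideal (𝓞 L)) [P.IsPrime] (hP : (3 : 𝓞 L) ∈ P)
    (hram : P.ramificationIdx (𝓞 K) = e * 3 ^ m)
    -- the Galois group embeds into `GL₂` of a finite field with `3 ^ a` elements
    (a : ℕ) (ha : 1 ≤ a) (ρ : Gal(L/K) →* GL (Fin 2) (GaloisField 3 a))
    (hρ : Function.Injective ρ) :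
    ∃ c : ℝ, c ≤ 2 - 1 / (2 * 3 ^ (m - 1 : ℕ)) - 1 / (2 * (e : ℝ) * 3 ^ m) ∧
      |(NumberField.discr L : ℝ)| ≤ |(NumberField.discr K : ℝ)| ^ n * (3 : ℝ) ^ (2 * c * (n : ℝ)) := by
  -- The largest admissible `c` is taken.
  refine ⟨_, le_rfl, ?_⟩
  have he0 : 0 < e := Nat.pos_of_ne_zero (by rintro rfl; norm_num at he)
  obtain ⟨p, hp, h3p, hpram⟩ := hK3
  obtain ⟨hep, hNp, huniq⟩ := quadratic_ramified hK Nat.prime_three p (by simpa using h3p) hpram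
  have hp0 : p ≠ ⊥ := by
    rintro rfl
    exact (OfNat.ofNat_ne_zero 3 : (3 : 𝓞 K) ≠ 0) ((Submodule.mem_bot _).1 h3p)
  have hover (Q : Ideal (𝓞 L)) [Q.IsPrime] (hQ : (3 : 𝓞 L) ∈ Q) : Q.LiesOver p := by
    refine ⟨(huniq (Q.under (𝓞 K)) ?_).symm⟩
    rw [Ideal.under_def, Ideal.mem_comap, map_natCast]
    simpa using hQ
  have hmem3 (Q : Ideal (𝓞 L)) [Q.IsPrime] [Q.LiesOver p] : (3 : 𝓞 L) ∈ Q := by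
    have : (3 : 𝓞 K) ∈ Q.under (𝓞 K) := Ideal.over_def Q p ▸ h3p
    rwa [Ideal.under_def, Ideal.mem_comap, map_ofNat] at this
  have := hover P hP
  have hramQ (Q : Ideal (𝓞 L)) [Q.IsPrime] [Q.LiesOver p] :
      Q.ramificationIdx (𝓞 K) = e * 3 ^ m := by
    rw [← hram]; exact Ideal.ramificationIdx_eq_of_isGaloisGroup p Q P Gal(L/K)
  have hdiff (Q : Ideal (𝓞 L)) [Q.IsPrime] [Q.LiesOver p] :=
    emultiplicity_differentIdeal_le he Q (hmem3 Q) (hramQ Q)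
      (by rw [Ideal.ramificationIdx_tower (R := ℤ) p Q, hep, hramQ Q]) ρ hρ
  have key := absNorm_differentIdeal_pow_le p hp0
    (fun Q _ hQ hQp => hunr Q hQ fun h => hQp (hover Q h)) (fun Q _ _ => hramQ Q)
    (fun Q _ _ => hdiff Q)
  rw [hNp, hn] at key
  have hdisc := NumberField.natAbs_discr_eq_absNorm_differentIdeal_mul_natAbs_discr_pow K (𝓞 K) L
    (𝓞 L)
  rw [hn] at hdisc
  rw [← Int.cast_abs, ← Int.cast_abs, ← Nat.cast_natAbs, ← Nat.cast_natAbs, hdisc, mul_comm]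
  push_cast
  gcongr
  set D := (differentIdeal (𝓞 K) (𝓞 L)).absNorm
  have hE : e * 3 ^ m ≠ 0 := by positivity
  refine le_of_pow_le_pow_left₀ hE (by positivity) ?_
  rw [← Real.rpow_mul_natCast (by norm_num)]
  have key' : (D : ℝ) ^ (e * 3 ^ m) ≤ ((3 : ℝ) ^ n) ^ ((3 ^ m - 1) * (3 * e + 1) + 3 ^ m * (e - 1)) := by
    exact_mod_cast key
  refine key'.trans (le_of_eq ?_)
  rw [← pow_mul, ← Real.rpow_natCast]
  -- What remains is `n * B = 2 * c * n * (e * 3 ^ m)`, that is `B / (e * 3 ^ m) = 4 - 1 / 3 ^ (m -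
  -- 1) - 1 / (e * 3 ^ m)`.
  congr 1
  obtain ⟨k, rfl⟩ : ∃ k, m = k + 1 := ⟨m - 1, by omega⟩
  have h1 : 1 ≤ 3 ^ (k + 1) := Nat.one_le_pow _ _ (by norm_num)
  push_cast [Nat.cast_sub h1, Nat.cast_sub he0]
  have he0' : (e : ℝ) ≠ 0 := by positivity
  field_simp
  ring
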